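/- **Theorem.** Let $T>0$ and $n\ge 1$. For every $\varepsilon>0$ let $\theta_\varepsilon$ be a process, defined on some probability space, with $\theta_\varepsilon(\cdot,\omega)\in L^2([0,T])$ for all $\omega$, and such that $\eta_\varepsilon(t)=\int_0^t\theta_\varepsilon(s)\,ds$, $t\in[0,T]$, is a real-valued stochastic process (thus $\eta_\varepsilon$ has paths in the Cameron–Martin space). Assume that the finite-dimensional distributions of $(\eta_\varepsilon)_{\varepsilon>0}$ converge in law, as $\varepsilon\downarrow 0$, to those of a standard Brownian motion $W$. For $f\in L^2([0,T]^n)$ and $t\in[0,T]$ set $$Y^f_{\eta_\varepsilon}(t)=\int_{[0,t]^n} f(x_1,\dots,x_n)\prod_{i=1}^n\theta_\varepsilon(x_i)\prod_{\substack{i,j=1\\ i\ne j}}^n \mathbf 1_{\{|x_i-x_j|>\varepsilon\}}\,dx_1\cdots dx_n .$$ Assume also that there is a constant $C>0$ such that $$\sup_{\varepsilon>0,\;t\in[0,T]}E\bigl|Y^f_{\eta_\varepsilon}(t)\bigr|\le C\,\|f\|_{L^2([0,T]^n)}\qquad\text{for all } f\in L^2([0,T]^n).$$ Then, for every $f\in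 L^2([0,T]^n)$, the finite-dimensional distributions of the processes $Y^f_{\eta_\varepsilon}=(Y^f_{\eta_\varepsilon}(t))_{t\in[0,T]}$ converge in law, as $\varepsilon\downarrow0$, to those of the process $\bigl(I_n(f\cdot\mathbf 1_{[0,t]^n})\bigr)_{t\in[0,T]}$. That is, for all $t_1,\dots,t_r\in[0,T]$, the random vector $(Y^f_{\eta_\varepsilon}(t_1),\dots,Y^f_{\eta_\varepsilon}(t_r))$ converges in law to $(I_n(f\cdot\mathbf 1_{[0,t_1]^n}),\dots,I_n(f\cdot\mathbf 1_{[0,t_r]^n}))$. Here $I_n$ denotes the multiple Wiener–Itô integral with respect to $W$. It is given by $I_n(g)=\sum_k\alpha_k\prod_{i=1}^n\bigl(W(b_k^i)-W(a_k^i)\bigr)$ for finite sums $g=\sum_k\alpha_k\mathbf 1_{(a_k^1,b_k^1]\times\cdots\times(a_k^n,b_k^n]}$ of rectangles in $[0,T]^n$ with $[a_k^h,b_k^h]\cap[a_k^l,b_k^l]=\emptyset$ for $h\ne l$, and is extended to $L^2([0,T]^n)$ by $L^2$-limits. -/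

import Mathlib

open MeasureTheory ProbabilityTheory Filter Topology
open scoped NNReal ENNReal

/-- The cube `[0, t]ⁿ` in `ℝⁿ`. -/
def cube (n : ℕ) (t : ℝ≥0) : Set (Fin n → ℝ) :=
  Set.univ.pi fun _ => Set.Icc (0 : ℝ) t

/-- Lebesgue measure on the cube `[0, T]ⁿ`; `L²([0, T]ⁿ)` is `L²` of this measure. -/
noncomputable def cubeMeasure (n : ℕ) (T : ℝ≥0) : Measure (Fin n → ℝ) :=
  volume.restrict (cube n T)

/-- The path `t ↦ ∫₀ᵗ g(s) ds`. It belongs to the Cameron–Martin space of `[0, T]` when `g` is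
square integrable on `[0, T]`. -/
noncomputable def primitivePath (g : ℝ → ℝ) (t : ℝ≥0) : ℝ :=
  ∫ s in (0 : ℝ)..t, g s

/-- The product over all `i ≠ j` of the indicators of `{|x_i - x_j| > ε}`. -/
noncomputable def offDiagonalCutoff {n : ℕ} (ε : ℝ) (x : Fin n → ℝ) : ℝ :=
  ∏ p ∈ (Finset.univ : Finset (Fin n)).offDiag,
    {y : Fin n → ℝ | ε < |y p.1 - y p.2|}.indicator (fun _ => (1 : ℝ)) x

/-- The truncated multiple integral over `[0, t]ⁿ` of `f` against `dη ⋯ dη`, where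
`dη = g(s) ds`, with the strips `|x_i - x_j| ≤ ε` removed. -/
noncomputable def truncatedIntegral {n : ℕ} (f : (Fin n → ℝ) → ℝ) (ε : ℝ) (g : ℝ → ℝ)
    (t : ℝ≥0) : ℝ :=
  ∫ x in cube n t, f x * (∏ i, g (x i)) * offDiagonalCutoff ε x

/-- Convergence in law, along `l`, of all finite-dimensional distributions of the real processes
`(X i t)_{t ∈ [0, T]}` to those of `(Z t)_{t ∈ [0, T]}`. The processes may live on different
probability spaces. -/
def TendstoFDD {ι : Type*} {Ω : ι → Type*} {Ω' : Type*} [∀ i, MeasurableSpace (Ω i)]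
    [MeasurableSpace Ω'] (T : ℝ≥0) (X : ∀ i, ℝ≥0 → Ω i → ℝ) (l : Filter ι)
    (Z : ℝ≥0 → Ω' → ℝ) (P : ∀ i, Measure (Ω i)) [∀ i, IsProbabilityMeasure (P i)]
    (P' : Measure Ω') [IsProbabilityMeasure P'] : Prop :=
  ∀ (r : ℕ) (t : Fin r → ℝ≥0), (∀ k, t k ≤ T) →
    TendstoInDistribution (fun i (ω : Ω i) (k : Fin r) => X i (t k) ω) l
      (fun (ω : Ω') (k : Fin r) => Z (t k) ω) P P'

/-- A half-open rectangle `(a₁, b₁] × ⋯ × (aₙ, bₙ]` in `[0, T]ⁿ` whose closed sides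
`[a_h, b_h]` are pairwise disjoint, so that it stays away from the diagonals. -/
structure OffDiagonalRect (n : ℕ) (T : ℝ≥0) where
  a : Fin n → ℝ≥0
  b : Fin n → ℝ≥0
  le : ∀ i, a i ≤ b i
  le_T : ∀ i, b i ≤ T
  disjoint : Pairwise fun h l => Disjoint (Set.Icc (a h) (b h)) (Set.Icc (a l) (b l))

/-- The set of points of a rectangle. -/
def OffDiagonalRect.toSet {n : ℕ} {T : ℝ≥0} (Δ : OffDiagonalRect n T) : Set (Fin n → ℝ) :=
  Set.univ.pi fun i => Set.Ioc (Δ.a i : ℝ) (Δ.b i)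

/-- The simple function `∑ₖ αₖ 1_{Δₖ}`, for a finite family of coefficients `αₖ` and
off-diagonal rectangles `Δₖ`. -/
noncomputable def simpleFun {n : ℕ} {T : ℝ≥0} (α : OffDiagonalRect n T →₀ ℝ)
    (x : Fin n → ℝ) : ℝ :=
  α.sum fun Δ c => c * Δ.toSet.indicator (fun _ => (1 : ℝ)) x

/-- The multiple integral of `∑ₖ αₖ 1_{Δₖ}` with respect to the process `W`, that is
`∑ₖ αₖ ∏ᵢ (W(bₖⁱ) - W(aₖⁱ))`. -/
noncomputable def simpleIntegral {Ω : Type*} {n : ℕ} {T : ℝ≥0} (W : ℝ≥0 → Ω → ℝ)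
    (α : OffDiagonalRect n T →₀ ℝ) (ω : Ω) : ℝ :=
  α.sum fun Δ c => c * ∏ i, (W (Δ.b i) ω - W (Δ.a i) ω)

/-- `X` is (a version of) the multiple Wiener–Itô integral of `f ∈ L²([0, T]ⁿ)` with respect
to `W`: there are simple functions converging to `f` in `L²([0, T]ⁿ)` whose integrals
converge to `X` in `L²(P)`. -/
def IsMultipleWienerIto {Ω : Type*} [MeasurableSpace Ω] {n : ℕ} (P : Measure Ω)
    (W : ℝ≥0 → Ω → ℝ) (T : ℝ≥0) (f : (Fin n → ℝ) → ℝ) (X : Ω → ℝ) : Prop :=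
  MemLp X 2 P ∧ ∃ α : ℕ → OffDiagonalRect n T →₀ ℝ,
    Tendsto (fun k => eLpNorm (fun x => simpleFun (α k) x - f x) 2 (cubeMeasure n T))
      atTop (𝓝 0) ∧
    Tendsto (fun k => eLpNorm (fun ω => simpleIntegral W (α k) ω - X ω) 2 P) atTop (𝓝 0)

open Classical in
/-- The multiple Wiener–Itô integral `Iₙ(f)` with respect to `W`, as a random variable. When `W`
is a Brownian motion and `f ∈ L²([0, T]ⁿ)` it exists and is unique up to a null event; the value
`0` is only used outside this situation. -/
noncomputable def multipleWienerIto {Ω : Type*} [MeasurableSpace Ω] {n : ℕ} (P : Measure Ω)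
    (W : ℝ≥0 → Ω → ℝ) (T : ℝ≥0) (f : (Fin n → ℝ) → ℝ) : Ω → ℝ :=
  if h : ∃ X, IsMultipleWienerIto P W T f X then h.choose else 0

/-! The proof is a density argument. If `g` is a finite sum over off-diagonal rectangles, then for
`ε` below the smallest gap between the sides of any one rectangle the cutoff equals 1 on the support
of `g`. Fubini then turns the truncated integral into the same polynomial in the increments of `η_ε`
that defines `Iₙ(g)` from the increments of `W`. Convergence in law of such integrals is therefore
the continuous mapping theorem applied to finitely many times (`TendstoFDD.simpleIntegral`).

For general `f`, the integral up to `t` is the integral up to `T` of `f · 1_{[0,t]ⁿ}`, so a vector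
of times becomes a vector of integrands `F k` at the single time `T`. Each `F k` is approximated in
`L²` by simple functions. The assumed bound makes the error on the `η_ε` side small in `L¹`
uniformly for small `ε`; the definition of `Iₙ` makes the error on the limit side small.
`tendstoInDistribution_of_approx` then passes to the limit.

Two facts of Wiener–Itô theory support this: simple functions that avoid the diagonals are dense in
`L²` (`exists_simpleFun_eLpNorm_sub_lt`), because the diagonals are null; and the integral of simple
functions is bounded in `L²` (`integral_sq_simpleIntegral_le`), by orthogonality of products of
Brownian increments over distinct sets of cells, so that `Iₙ` exists. -/

/-! ### Convergence in law through `L¹` approximation -/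

lemma abs_integral_comp_sub_le_of_lipschitzWith {Ω E : Type*} [MeasurableSpace Ω]
    {P : Measure Ω} [IsProbabilityMeasure P] [SeminormedAddCommGroup E] [MeasurableSpace E]
    [BorelSpace E] [SecondCountableTopology E] {F : E → ℝ} {L : ℝ≥0} (hF : LipschitzWith L F)
    (hFb : ∃ M, ∀ x y, dist (F x) (F y) ≤ M) {X Y : Ω → E} (hX : AEMeasurable X P)
    (hY : AEMeasurable Y P) {δ : ℝ≥0} (h : ∫⁻ ω, ‖X ω - Y ω‖ₑ ∂P ≤ δ) :
    |∫ ω, F (X ω) ∂P - ∫ ω, F (Y ω) ∂P| ≤ L * δ := by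
  obtain ⟨M, hM⟩ := hFb
  have hint : ∀ Z : Ω → E, AEMeasurable Z P → Integrable (fun ω => F (Z ω)) P := by
    intro Z hZ
    refine Integrable.of_bound (hF.continuous.measurable.comp_aemeasurable hZ).aestronglyMeasurable
      (|F 0| + M) (ae_of_all _ fun ω => ?_)
    have h1 := hM (Z ω) 0
    rw [Real.dist_eq] at h1
    have h2 := abs_sub_abs_le_abs_sub (F (Z ω)) (F 0)
    rw [Real.norm_eq_abs]
    linarith
  rw [← integral_sub (hint X hX) (hint Y hY), ← Real.norm_eq_abs]
  have h1 : ∫⁻ ω, ‖F (X ω) - F (Y ω)‖ₑ ∂P ≤ (L * δ : ℝ≥0) := by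
    calc ∫⁻ ω, ‖F (X ω) - F (Y ω)‖ₑ ∂P ≤ ∫⁻ ω, L * ‖X ω - Y ω‖ₑ ∂P := by
          refine lintegral_mono fun ω => ?_
          rw [← edist_eq_enorm_sub, ← edist_eq_enorm_sub]
          exact hF (X ω) (Y ω)
      _ = L * ∫⁻ ω, ‖X ω - Y ω‖ₑ ∂P := lintegral_const_mul' _ _ ENNReal.coe_ne_top
      _ ≤ L * δ := by gcongr
      _ = (L * δ : ℝ≥0) := by push_cast; rfl
  have h2 : ‖∫ ω, F (X ω) - F (Y ω) ∂P‖ₑ ≤ (L * δ : ℝ≥0) :=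
    (enorm_integral_le_lintegral_enorm _).trans h1
  rw [← ofReal_norm, ENNReal.ofReal_le_coe] at h2
  simpa using h2

/-- A family of random variables converges in distribution if it can be approximated in `L¹`,
uniformly near the limit, by families that converge in distribution. -/
lemma tendstoInDistribution_of_approx {ι E Ω' : Type*} {Ω : ι → Type*}
    [∀ i, MeasurableSpace (Ω i)] [MeasurableSpace Ω'] {P : ∀ i, Measure (Ω i)}
    [∀ i, IsProbabilityMeasure (P i)] {P' : Measure Ω'} [IsProbabilityMeasure P']
    [SeminormedAddCommGroup E] [MeasurableSpace E] [BorelSpace E] [SecondCountableTopology E]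
    {l : Filter ι} [l.IsCountablyGenerated] {X : ∀ i, Ω i → E} {Z : Ω' → E}
    (hX : ∀ i, AEMeasurable (X i) (P i)) (hZ : AEMeasurable Z P')
    {Xa : ℕ → ∀ i, Ω i → E} {Za : ℕ → Ω' → E}
    (h : ∀ k, TendstoInDistribution (Xa k) l (Za k) P P') {δ : ℕ → ℝ≥0∞}
    (hδ : Tendsto δ atTop (𝓝 0))
    (hXa : ∀ k, ∀ᶠ i in l, ∫⁻ ω, ‖X i ω - Xa k i ω‖ₑ ∂(P i) ≤ δ k)
    (hZa : ∀ k, ∫⁻ ω, ‖Za k ω - Z ω‖ₑ ∂P' ≤ δ k) :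
    TendstoInDistribution X l Z P P' where
  forall_aemeasurable := hX
  aemeasurable_limit := hZ
  tendsto := by
    -- Bounded Lipschitz test functions suffice, and for these an `L¹` error `δ` costs at most `L *
    -- δ`.
    refine tendsto_iff_forall_lipschitz_integral_tendsto.2 ?_
    rintro F hFb ⟨L, hF⟩
    simp only [ProbabilityMeasure.coe_mk]
    rw [Metric.tendsto_nhds]
    intro e he
    have hcont := hF.continuous
    -- Each of the three errors gets `e / 3`; `L + 1` replaces `L` to avoid dividing by zero.
    obtain ⟨k, hk⟩ := ((tendsto_order.1 hδ).2 (Real.toNNReal (e / (3 * (L + 1)))) (by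
      rw [gt_iff_lt, ENNReal.coe_pos, Real.toNNReal_pos]; positivity)).exists
    have hk' : δ k ≠ ∞ := (hk.trans ENNReal.coe_lt_top).ne
    lift δ k to ℝ≥0 using hk' with d hd
    have hLd : L * d < e / 3 := by
      have h1 : (d : ℝ) < e / (3 * (L + 1)) := by
        rw [ENNReal.coe_lt_coe] at hk
        exact Real.lt_toNNReal_iff_coe_lt.1 hk
      rw [lt_div_iff₀ (by positivity)] at h1
      have h3 : (0 : ℝ) ≤ d := d.2
      nlinarith
    have hlim := (tendsto_iff_forall_lipschitz_integral_tendsto.1 (h k).tendsto) F hFb ⟨L, hF⟩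
    simp only [ProbabilityMeasure.coe_mk] at hlim
    have hXk := hXa k
    have hZk := hZa k
    rw [← hd] at hXk hZk
    have hmi := (h k).forall_aemeasurable
    have hml := (h k).aemeasurable_limit
    filter_upwards [(Metric.tendsto_nhds.1 hlim) (e / 3) (by positivity), hXk] with i h1 h2
    have h4 := abs_integral_comp_sub_le_of_lipschitzWith hF hFb (hX i) (hmi i) h2
    have h5 := abs_integral_comp_sub_le_of_lipschitzWith hF hFb hml hZ hZk
    rw [integral_map (hmi i) hcont.aestronglyMeasurable,
      integral_map hml hcont.aestronglyMeasurable, Real.dist_eq] at h1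
    rw [integral_map (hX i) hcont.aestronglyMeasurable,
      integral_map hZ hcont.aestronglyMeasurable, Real.dist_eq]
    rw [abs_lt] at h1 ⊢
    rw [abs_le] at h4 h5
    constructor <;> linarith

/-! ### Density of off-diagonal simple functions in `L²` -/

instance isFiniteMeasure_cubeMeasure (n : ℕ) (T : ℝ≥0) : IsFiniteMeasure (cubeMeasure n T) := by
  refine ⟨?_⟩
  rw [cubeMeasure, Measure.restrict_apply_univ, cube]
  exact (isCompact_univ_pi fun _ => isCompact_Icc).measure_lt_top

lemma measurableSet_cube (n : ℕ) (t : ℝ≥0) : MeasurableSet (cube n t) :=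
  MeasurableSet.univ_pi fun _ => measurableSet_Icc

namespace OffDiagonalRect

variable {n : ℕ} {T : ℝ≥0}

lemma measurableSet_toSet (Δ : OffDiagonalRect n T) : MeasurableSet Δ.toSet :=
  MeasurableSet.univ_pi fun _ => measurableSet_Ioc

end OffDiagonalRect

variable {n : ℕ} {T : ℝ≥0}

/-- An integrable function whose integrals over all off-diagonal rectangles vanish is zero
almost everywhere on each of these rectangles. -/
lemma ae_eq_zero_on_rect {g : (Fin n → ℝ) → ℝ} (hg : Integrable g (cubeMeasure n T))
    (h : ∀ Δ : OffDiagonalRect n T, ∫ x in Δ.toSet, g x ∂(cubeMeasure n T) = 0)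
    (Δ : OffDiagonalRect n T) : g =ᵐ[(cubeMeasure n T).restrict Δ.toSet] 0 := by
  -- A π-λ argument: half-open boxes generate the σ-algebra, and a box intersected with `Δ` is empty
  -- or again an off-diagonal rectangle.
  refine hg.restrict.ae_eq_zero_of_forall_setIntegral_eq_zero fun s hs _ => ?_
  have hgen : (MeasurableSpace.pi : MeasurableSpace (Fin n → ℝ)) = MeasurableSpace.generateFrom
      (Set.univ.pi '' Set.univ.pi fun _ : Fin n => {S | ∃ l u : ℝ, l < u ∧ Set.Ioc l u = S}) := by
    refine (generateFrom_eq_pi (fun _ => ?_) fun _ => ?_).symm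
    · rw [← borel_eq_generateFrom_Ioc, BorelSpace.measurable_eq (α := ℝ)]
    · refine ⟨fun k : ℕ => Set.Ioc (-(k + 1 : ℝ)) (k + 1), fun k => ⟨_, _, ?_, rfl⟩, ?_⟩
      · have : (0 : ℝ) ≤ k := k.cast_nonneg
        linarith
      · refine Set.eq_univ_of_forall fun x => ?_
        obtain ⟨k, hk⟩ := exists_nat_ge |x|
        have := abs_le.1 hk
        exact Set.mem_iUnion.2 ⟨k, by constructor <;> linarith⟩
  have hpi : IsPiSystem
      (Set.univ.pi '' Set.univ.pi fun _ : Fin n => {S | ∃ l u : ℝ, l < u ∧ Set.Ioc l u = S}) :=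
    IsPiSystem.pi fun _ => isPiSystem_Ioc id id
  have hgi : Integrable g ((cubeMeasure n T).restrict Δ.toSet) := hg.restrict
  induction s, hs using MeasurableSpace.induction_on_inter hgen hpi with
  | empty => simp
  | basic s hs =>
    obtain ⟨S, hS, rfl⟩ := hs
    choose l u hlu hS' using fun i => hS i (Set.mem_univ i)
    rw [Measure.restrict_restrict (MeasurableSet.univ_pi fun i => by
      rw [← hS' i]; exact measurableSet_Ioc), OffDiagonalRect.toSet, ← Set.pi_inter_distrib]
    -- The box may have negative corners; truncating them at 0 does not change the intersection,
    -- since the sides of `Δ` lie in the nonnegative half-line.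
    by_cases hne : ∀ i, max (Δ.a i) (l i).toNNReal ≤ min (Δ.b i) (u i).toNNReal
    · have key := h ⟨fun i => max (Δ.a i) (l i).toNNReal, fun i => min (Δ.b i) (u i).toNNReal, hne,
        fun i => (min_le_left _ _).trans (Δ.le_T i), fun i j hij => (Δ.disjoint hij).mono
          (Set.Icc_subset_Icc (le_max_left _ _) (min_le_left _ _))
          (Set.Icc_subset_Icc (le_max_left _ _) (min_le_left _ _))⟩
      rw [OffDiagonalRect.toSet] at key
      convert key using 6 with i
      ext x
      rw [← hS' i]
      simp only [Set.mem_inter_iff, Set.mem_Ioc, NNReal.coe_max, NNReal.coe_min,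
        Real.coe_toNNReal', max_lt_iff, le_min_iff, le_max_iff]
      have := (Δ.a i).coe_nonneg
      clear key hgi hS hgen hpi h
      grind
    · push Not at hne
      obtain ⟨i, hi⟩ := hne
      have : (Set.univ.pi fun i => S i ∩ Set.Ioc (Δ.a i : ℝ) (Δ.b i)) = ∅ := by
        refine Set.univ_pi_eq_empty (i := i) ?_
        rw [← hS' i, Set.Ioc_inter_Ioc, Set.Ioc_eq_empty_iff, not_lt]
        rw [← NNReal.coe_lt_coe] at hi
        simp only [NNReal.coe_max, NNReal.coe_min, Real.coe_toNNReal'] at hi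
        have := (Δ.a i).coe_nonneg
        have := (Δ.b i).coe_nonneg
        clear hgi hS hgen hpi h
        have := NNReal.coe_le_coe.2 (Δ.le i)
        have := hlu i
        grind
      rw [this]; simp
  | compl s hs ih =>
    rw [setIntegral_compl hs hgi, ih (by exact measure_lt_top _ _), h Δ, sub_zero]
  | iUnion f hd hm ih =>
    have := hasSum_integral_iUnion hm hd hgi.integrableOn
    simp only [fun i => ih i (measure_lt_top _ _)] at this
    exact this.unique hasSum_zero

/-- A proper linear subspace is Lebesgue null. -/
lemma volume_setOf_apply_eq_apply {i j : Fin n} (hij : i ≠ j) :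
    volume {x : Fin n → ℝ | x i = x j} = 0 := by
  let V : Submodule ℝ (Fin n → ℝ) := LinearMap.ker
    ((LinearMap.proj i : (Fin n → ℝ) →ₗ[ℝ] ℝ) - LinearMap.proj j)
  have hV : V ≠ ⊤ := by
    intro hV
    have : (Pi.single i 1 : Fin n → ℝ) ∈ V := hV ▸ Submodule.mem_top
    simp [V, hij.symm] at this
  have := Measure.addHaar_submodule volume V hV
  convert this using 2
  ext x
  simp [V, sub_eq_zero]

/-- A small enough cube around a point with distinct coordinates has pairwise disjoint closed sides.
-/
lemma exists_rect_mem_nhds {x : Fin n → ℝ} (hx : ∀ i, 0 < x i ∧ x i < T)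
    (hinj : Function.Injective x) : ∃ Δ : OffDiagonalRect n T, Δ.toSet ∈ 𝓝 x := by
  obtain ⟨δ, hδ, h1, h2⟩ : ∃ δ > 0, (∀ i, δ < x i ∧ x i + δ < T) ∧
      ∀ i j, i ≠ j → 2 * δ < |x i - x j| := by
    have hcont (c : ℝ) : Tendsto (fun δ : ℝ => c * δ) (𝓝[>] 0) (𝓝 0) := by
      have : Continuous (fun δ : ℝ => c * δ) := by fun_prop
      simpa using (this.tendsto 0).mono_left nhdsWithin_le_nhds
    have hev : ∀ᶠ δ in 𝓝[>] (0 : ℝ), (∀ i, 1 * δ < x i ∧ 1 * δ < T - x i) ∧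
        ∀ i j, i ≠ j → 2 * δ < |x i - x j| := by
      refine (eventually_all.2 fun i => ?_).and (eventually_all.2 fun i => eventually_all.2 fun j =>
        ?_)
      · exact ((hcont 1).eventually_lt_const (hx i).1).and
          ((hcont 1).eventually_lt_const (sub_pos.2 (hx i).2))
      · by_cases hij : i = j
        · simp [hij]
        · have : 0 < |x i - x j| := abs_pos.2 (sub_ne_zero.2 (hinj.ne hij))
          filter_upwards [(hcont 2).eventually_lt_const this] with δ hδ _ using hδ
    obtain ⟨δ, hδ, hpos⟩ := (hev.and self_mem_nhdsWithin).exists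
    exact ⟨δ, hpos, fun i => ⟨by linarith [(hδ.1 i).1], by linarith [(hδ.1 i).2]⟩, hδ.2⟩
  have ha i : (0 : ℝ) ≤ x i - δ := by linarith [(h1 i).1]
  have hb i : (0 : ℝ) ≤ x i + δ := by linarith [(h1 i).1]
  refine ⟨⟨fun i => ⟨x i - δ, ha i⟩, fun i => ⟨x i + δ, hb i⟩, fun i => ?_, fun i => ?_,
    fun i j hij => ?_⟩, ?_⟩
  · change x i - δ ≤ x i + δ
    linarith
  · exact (h1 i).2.le
  · refine Set.disjoint_left.2 ?_
    rintro s ⟨hs1, hs2⟩ ⟨hs3, hs4⟩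
    have hs1' : x i - δ ≤ s := hs1
    have hs2' : (s : ℝ) ≤ x i + δ := hs2
    have hs3' : x j - δ ≤ s := hs3
    have hs4' : (s : ℝ) ≤ x j + δ := hs4
    have := h2 i j hij
    have : |x i - x j| ≤ 2 * δ := abs_le.2 ⟨by linarith, by linarith⟩
    linarith
  · refine set_pi_mem_nhds Set.finite_univ fun i _ => Ioc_mem_nhds ?_ ?_
    · change x i - δ < x i
      linarith
    · change x i < x i + δ
      linarith

/-- Diagonals and the boundary of the cube are null. Every other point has an off-diagonal rectangle
as a neighbourhood, on which `g` vanishes almost everywhere, and a locally null set is null. -/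
lemma ae_eq_zero_of_forall_rect {g : (Fin n → ℝ) → ℝ} (hg : Integrable g (cubeMeasure n T))
    (h : ∀ Δ : OffDiagonalRect n T, ∫ x in Δ.toSet, g x ∂(cubeMeasure n T) = 0) :
    g =ᵐ[cubeMeasure n T] 0 := by
  have hdiag : ∀ᵐ x ∂(cubeMeasure n T), Function.Injective x := by
    refine ae_restrict_of_ae ?_
    have : ∀ᵐ x : Fin n → ℝ, ∀ i j, i ≠ j → x i ≠ x j := by
      refine ae_all_iff.2 fun i => ae_all_iff.2 fun j => ?_
      by_cases hij : i = j
      · simp [hij]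
      · simpa [ae_iff, hij] using volume_setOf_apply_eq_apply hij
    filter_upwards [this] with x hx i j
    exact not_imp_not.1 (hx i j)
  have hint : ∀ᵐ x ∂(cubeMeasure n T), ∀ i, 0 < x i ∧ x i < (T : ℝ) := by
    have h1 : (Set.univ.pi fun _ : Fin n => Set.Ioo (0 : ℝ) T) =ᵐ[volume] cube n T := by
      rw [cube, Set.pi_univ_Icc]
      exact Measure.univ_pi_Ioo_ae_eq_Icc
    rw [cubeMeasure, Measure.restrict_congr_set h1.symm]
    filter_upwards [ae_restrict_mem (MeasurableSet.univ_pi fun _ => measurableSet_Ioo)] with x hx i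
    exact hx i (Set.mem_univ i)
  have hnull : cubeMeasure n T
      {x | g x ≠ 0 ∧ Function.Injective x ∧ ∀ i, 0 < x i ∧ x i < (T : ℝ)} = 0 := by
    refine measure_null_of_locally_null _ fun x hx => ?_
    obtain ⟨Δ, hΔ⟩ := exists_rect_mem_nhds hx.2.2 hx.2.1
    refine ⟨Δ.toSet ∩ _, inter_mem (mem_nhdsWithin_of_mem_nhds hΔ) self_mem_nhdsWithin, ?_⟩
    have := ae_eq_zero_on_rect hg h Δ
    rw [EventuallyEq, ae_restrict_iff' Δ.measurableSet_toSet, ae_iff] at this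
    refine measure_mono_null (fun y hy => ?_) this
    simpa using ⟨hy.1, hy.2.1⟩
  rw [← compl_compl {x | g x ≠ 0 ∧ _}, ← mem_ae_iff] at hnull
  filter_upwards [hnull, hdiag, hint] with x h1 h2 h3
  by_contra h4
  exact h1 ⟨h4, h2, h3⟩

/-- Simple functions over off-diagonal rectangles are dense in `L²([0, T]ⁿ)`. -/
lemma exists_simpleFun_eLpNorm_sub_lt {f : (Fin n → ℝ) → ℝ} (hf : MemLp f 2 (cubeMeasure n T))
    {e : ℝ≥0∞} (he : 0 < e) : ∃ α : OffDiagonalRect n T →₀ ℝ,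
      eLpNorm (fun x => simpleFun α x - f x) 2 (cubeMeasure n T) < e := by
  let v : OffDiagonalRect n T → Lp ℝ 2 (cubeMeasure n T) := fun Δ =>
    indicatorConstLp 2 Δ.measurableSet_toSet (measure_ne_top _ _) 1
  -- Density by duality: a function orthogonal to all the indicators has zero integral over every
  -- rectangle.
  have htop : (Submodule.span ℝ (Set.range v)).topologicalClosure = ⊤ := by
    rw [Submodule.topologicalClosure_eq_top_iff, Submodule.eq_bot_iff]
    intro g hg
    have hg' : ∀ Δ : OffDiagonalRect n T, ∫ x in Δ.toSet, g x ∂(cubeMeasure n T) = 0 := by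
      intro Δ
      rw [← L2.inner_indicatorConstLp_one (𝕜 := ℝ) Δ.measurableSet_toSet (measure_ne_top _ _)]
      exact (Submodule.mem_orthogonal _ _).1 hg _ (Submodule.subset_span ⟨Δ, rfl⟩)
    rw [Lp.eq_zero_iff_ae_eq_zero]
    exact ae_eq_zero_of_forall_rect ((Lp.memLp g).integrable one_le_two) hg'
  have hmem : hf.toLp f ∈ closure (Submodule.span ℝ (Set.range v) : Set _) := by
    rw [← Submodule.topologicalClosure_coe, htop]
    trivial
  obtain ⟨y, hy, hye⟩ := EMetric.mem_closure_iff.1 hmem e he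
  obtain ⟨α, rfl⟩ := Finsupp.mem_span_range_iff_exists_finsupp.1 hy
  refine ⟨α, ?_⟩
  rw [edist_comm, Lp.edist_def] at hye
  refine (eLpNorm_congr_ae ?_).trans_lt hye
  have h1 : ∀ᵐ x ∂(cubeMeasure n T), ∀ Δ ∈ α.support,
      v Δ x = Δ.toSet.indicator (fun _ => (1 : ℝ)) x := by
    refine (ae_ball_iff α.support.countable_toSet).2 fun Δ _ => indicatorConstLp_coeFn
  have h2 : ∀ᵐ x ∂(cubeMeasure n T), ∀ Δ ∈ α.support, (α Δ • v Δ) x = α Δ * v Δ x := by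
    refine (ae_ball_iff α.support.countable_toSet).2 fun Δ _ => ?_
    exact Lp.coeFn_smul _ _
  have h3 := Lp.coeFn_finsetSum α.support fun Δ => α Δ • v Δ
  filter_upwards [h1, h2, h3, hf.coeFn_toLp] with x h1 h2 h3 h4
  rw [Pi.sub_apply, h4, simpleFun, Finsupp.sum, Finsupp.sum, h3, Finset.sum_apply]
  congr 1
  exact Finset.sum_congr rfl fun Δ hΔ => by rw [h2 Δ hΔ, h1 Δ hΔ]

lemma exists_seq_simpleFun_tendsto {f : (Fin n → ℝ) → ℝ} (hf : MemLp f 2 (cubeMeasure n T)) :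
    ∃ α : ℕ → OffDiagonalRect n T →₀ ℝ,
      Tendsto (fun k => eLpNorm (fun x => simpleFun (α k) x - f x) 2 (cubeMeasure n T))
        atTop (𝓝 0) := by
  have (k : ℕ) : ∃ α : OffDiagonalRect n T →₀ ℝ,
      eLpNorm (fun x => simpleFun α x - f x) 2 (cubeMeasure n T) < (k : ℝ≥0∞)⁻¹ :=
    exists_simpleFun_eLpNorm_sub_lt hf (by simp)
  choose α hα using this
  exact ⟨α, tendsto_of_tendsto_of_tendsto_of_le_of_le tendsto_const_nhds
    ENNReal.tendsto_inv_nat_nhds_zero (fun _ => zero_le) fun k => (hα k).le⟩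

/-! ### Expansion over a common grid -/

lemma cubeMeasure_eq_pi (n : ℕ) (T : ℝ≥0) :
    cubeMeasure n T = Measure.pi fun _ => volume.restrict (Set.Icc (0 : ℝ) T) :=
  Measure.restrict_pi_pi _ _

/-- Telescoping, written as a sum over all cells so that products over the coordinates can be
expanded by distributivity. -/
lemma sub_eq_sum_cells {M : ℕ} (φ : Fin (M + 1) → ℝ) {u v : Fin (M + 1)} (huv : u ≤ v) :
    φ v - φ u = ∑ k : Fin M,
      if u ≤ k.castSucc ∧ k.succ ≤ v then φ k.succ - φ k.castSucc else 0 := by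
  induction v using Fin.induction with
  | zero =>
    obtain rfl : u = 0 := le_antisymm huv (Fin.zero_le _)
    simp
  | succ j ih =>
    rcases huv.eq_or_lt with rfl | huv
    · rw [sub_self, Finset.sum_eq_zero fun k _ => if_neg ?_]
      rintro ⟨h1, h2⟩
      exact absurd (h2.trans h1) (not_le.2 Fin.castSucc_lt_succ)
    · have huj : u ≤ j.castSucc := Fin.le_castSucc_iff.2 huv
      have hstep : ∀ k : Fin M, (if u ≤ k.castSucc ∧ k.succ ≤ j.succ then
          φ k.succ - φ k.castSucc else 0) = (if u ≤ k.castSucc ∧ k.succ ≤ j.castSucc then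
          φ k.succ - φ k.castSucc else 0) + if k = j then φ k.succ - φ k.castSucc else 0 := by
        intro k
        rcases lt_trichotomy k j with h | rfl | h
        · have h1 : k.succ ≤ j.succ := Fin.succ_le_succ_iff.2 h.le
          have h2 : k.succ ≤ j.castSucc := Fin.succ_le_castSucc_iff.2 h
          simp [h1, h2, h.ne]
        · have : ¬ k.succ ≤ k.castSucc := not_le.2 Fin.castSucc_lt_succ
          simp [huj, this]
        · have h1 : ¬ k.succ ≤ j.succ := not_le.2 (Fin.succ_lt_succ_iff.2 h)
          have h2 : ¬ k.succ ≤ j.castSucc := fun h' => h1 (h'.trans Fin.castSucc_lt_succ.le)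
          simp [h1, h2, h.ne']
      rw [Finset.sum_congr rfl fun k _ => hstep k, Finset.sum_add_distrib, ← ih huj]
      simp

/-- The multilinear expressions attached to a family of off-diagonal rectangles expand over the
cells of a common grid, and only cells with pairwise distinct sides occur. -/
lemma exists_grid_expansion (α : OffDiagonalRect n T →₀ ℝ) :
    ∃ (M : ℕ) (p : Fin (M + 1) → ℝ≥0) (A : (Fin n → Fin M) → ℝ), Monotone p ∧ (∀ k, p k ≤ T) ∧
      (∀ κ, ¬ Function.Injective κ → A κ = 0) ∧
      ∀ φ : Fin n → ℝ≥0 → ℝ, (α.sum fun Δ c => c * ∏ i, (φ i (Δ.b i) - φ i (Δ.a i))) =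
        ∑ κ, A κ * ∏ i, (φ i (p (κ i).succ) - φ i (p (κ i).castSucc)) := by
  classical
  -- The grid consists of all endpoints that occur; adding 0 makes it nonempty, so that it has `M +
  -- 1` points.
  let F : Finset ℝ≥0 := insert 0 (α.support.biUnion fun Δ =>
    Finset.univ.image Δ.a ∪ Finset.univ.image Δ.b)
  have hF : F.card = (F.card - 1) + 1 := by
    have : 0 < F.card := Finset.card_pos.2 ⟨0, Finset.mem_insert_self _ _⟩
    omega
  set M := F.card - 1
  let p : Fin (M + 1) ↪o ℝ≥0 := F.orderEmbOfFin hF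
  have hrange : ∀ s ∈ F, ∃ k, p k = s := fun s hs => by
    have : s ∈ Set.range p := by rw [Finset.range_orderEmbOfFin]; exact hs
    exact this
  have hleT : ∀ s ∈ F, s ≤ T := by
    intro s hs
    simp only [F, Finset.mem_insert, Finset.mem_biUnion, Finset.mem_union, Finset.mem_image,
      Finset.mem_univ, true_and] at hs
    rcases hs with rfl | ⟨Δ, -, ⟨i, rfl⟩ | ⟨i, rfl⟩⟩
    · exact zero_le
    · exact (Δ.le i).trans (Δ.le_T i)
    · exact Δ.le_T i
  have hsub : ∀ Δ ∈ α.support, ∀ i, ∀ φ : ℝ≥0 → ℝ, φ (Δ.b i) - φ (Δ.a i) = ∑ k : Fin M,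
      (if Δ.a i ≤ p k.castSucc ∧ p k.succ ≤ Δ.b i then (1 : ℝ) else 0) *
        (φ (p k.succ) - φ (p k.castSucc)) := by
    intro Δ hΔ i φ
    obtain ⟨u, hu⟩ := hrange (Δ.a i) (Finset.mem_insert_of_mem (Finset.mem_biUnion.2
      ⟨Δ, hΔ, Finset.mem_union_left _ (Finset.mem_image_of_mem _ (Finset.mem_univ i))⟩))
    obtain ⟨v, hv⟩ := hrange (Δ.b i) (Finset.mem_insert_of_mem (Finset.mem_biUnion.2
      ⟨Δ, hΔ, Finset.mem_union_right _ (Finset.mem_image_of_mem _ (Finset.mem_univ i))⟩))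
    have huv : u ≤ v := by
      rw [← p.le_iff_le, hu, hv]
      exact Δ.le i
    rw [← hu, ← hv, sub_eq_sum_cells (fun k => φ (p k)) huv]
    simp only [p.le_iff_le, ite_mul, one_mul, zero_mul]
  refine ⟨M, p, fun κ => ∑ Δ ∈ α.support, α Δ *
    ∏ i, if Δ.a i ≤ p (κ i).castSucc ∧ p (κ i).succ ≤ Δ.b i then (1 : ℝ) else 0, p.monotone,
    fun k => hleT _ (Finset.orderEmbOfFin_mem _ _ _), ?_, ?_⟩
  · intro κ hκ
    simp only [Function.Injective, not_forall] at hκ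
    obtain ⟨i, j, hij, hne⟩ := hκ
    refine Finset.sum_eq_zero fun Δ _ => mul_eq_zero_of_right _ ?_
    rw [Finset.prod_ite_zero, if_neg]
    intro h
    have hi := h i (Finset.mem_univ i)
    have hj := h j (Finset.mem_univ j)
    -- If `κ i = κ j`, this left endpoint lies in two closed sides of `Δ`, which are disjoint.
    have hle : p (κ i).castSucc ≤ p (κ i).succ := p.monotone Fin.castSucc_lt_succ.le
    rw [← hij] at hj
    exact Set.disjoint_left.1 (Δ.disjoint hne) ⟨hi.1, hle.trans hi.2⟩ ⟨hj.1, hle.trans hj.2⟩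
  · intro φ
    simp only [Finset.sum_mul]
    rw [Finset.sum_comm, Finsupp.sum]
    refine Finset.sum_congr rfl fun Δ hΔ => ?_
    rw [Finset.prod_congr rfl fun i _ => hsub Δ hΔ i (φ i), Finset.prod_univ_sum,
      Fintype.piFinset_univ, Finset.mul_sum]
    refine Finset.sum_congr rfl fun κ _ => ?_
    rw [Finset.prod_mul_distrib, mul_assoc]

lemma indicator_Ioc_eq_sub {a b : ℝ≥0} (hab : a ≤ b) (s : ℝ) :
    (if s ≤ b then (1 : ℝ) else 0) - (if s ≤ a then 1 else 0) =
      (Set.Ioc (a : ℝ) b).indicator (fun _ => 1) s := by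
  have : (a : ℝ) ≤ b := hab
  by_cases h1 : s ≤ a
  · simp [h1, h1.trans this]
  · by_cases h2 : s ≤ b
    · simp [h1, h2, not_le.1 h1]
    · simp [h1, h2]

lemma OffDiagonalRect.indicator_toSet (Δ : OffDiagonalRect n T) (x : Fin n → ℝ) :
    Δ.toSet.indicator (fun _ => (1 : ℝ)) x =
      ∏ i, (Set.Ioc (Δ.a i : ℝ) (Δ.b i)).indicator (fun _ => 1) (x i) := by
  classical
  simp only [Set.indicator_apply]
  rw [Finset.prod_ite_zero]
  simp [OffDiagonalRect.toSet]

/-- Puts a simple function in the form of a sum of products of increments, here of `s ↦ 1_{x i ≤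
s}`. The same grid expansion then serves for the function and for its integral. -/
lemma simpleFun_eq_sum_sub (α : OffDiagonalRect n T →₀ ℝ) (x : Fin n → ℝ) :
    simpleFun α x = α.sum fun Δ c => c * ∏ i, ((fun s : ℝ≥0 => if x i ≤ s then (1 : ℝ) else 0)
      (Δ.b i) - (fun s : ℝ≥0 => if x i ≤ s then (1 : ℝ) else 0) (Δ.a i)) := by
  rw [simpleFun]
  refine Finset.sum_congr rfl fun Δ _ => ?_
  simp only [Δ.indicator_toSet, indicator_Ioc_eq_sub (Δ.le _)]

/-- Distinct grid cells are disjoint, so the cross terms vanish. -/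
lemma integral_sq_sum_cells {M : ℕ} {p : Fin (M + 1) → ℝ≥0} (hp : Monotone p)
    (hpT : ∀ k, p k ≤ T) (A : (Fin n → Fin M) → ℝ) :
    ∫ x, (∑ κ, A κ * ∏ i, (Set.Ioc (p (κ i).castSucc : ℝ) (p (κ i).succ)).indicator
        (fun _ => (1 : ℝ)) (x i)) ^ 2 ∂(cubeMeasure n T) =
      ∑ κ, A κ ^ 2 * ∏ i, ((p (κ i).succ : ℝ) - p (κ i).castSucc) := by
  let D : Fin M → ℝ → ℝ := fun k =>
    (Set.Ioc (p k.castSucc : ℝ) (p k.succ)).indicator fun _ => 1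
  have hD1 : ∀ k, Integrable (D k) (volume.restrict (Set.Icc (0 : ℝ) T)) := fun k =>
    (integrable_const 1).indicator measurableSet_Ioc
  have hmul : ∀ k l, (fun s => D k s * D l s) = if k = l then D k else 0 := by
    intro k l
    ext s
    split_ifs with h
    · subst h
      by_cases hs : s ∈ Set.Ioc (p k.castSucc : ℝ) (p k.succ) <;> simp [D, hs]
    · wlog hkl : k < l generalizing k l
      · rw [mul_comm]
        exact this l k (Ne.symm h) (lt_of_le_of_ne (not_lt.1 hkl) (Ne.symm h))
      · have hle : (p k.succ : ℝ) ≤ p l.castSucc := hp (Fin.succ_le_castSucc_iff.2 hkl)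
        by_cases hs : s ∈ Set.Ioc (p k.castSucc : ℝ) (p k.succ)
        · have : s ∉ Set.Ioc (p l.castSucc : ℝ) (p l.succ) := fun h' =>
            absurd (hs.2.trans hle) (not_le.2 h'.1)
          simp [D, this]
        · simp [D, hs]
  have hDint : ∀ k, ∫ s in Set.Icc (0 : ℝ) T, D k s = (p k.succ : ℝ) - p k.castSucc := by
    intro k
    have hsub : Set.Ioc (p k.castSucc : ℝ) (p k.succ) ∩ Set.Icc 0 (T : ℝ) =
        Set.Ioc (p k.castSucc : ℝ) (p k.succ) := by
      refine Set.inter_eq_left.2 fun s hs => ⟨(p k.castSucc).coe_nonneg.trans hs.1.le, ?_⟩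
      exact hs.2.trans (hpT _)
    have hle : (p k.castSucc : ℝ) ≤ p k.succ := hp Fin.castSucc_lt_succ.le
    rw [integral_indicator measurableSet_Ioc, Measure.restrict_restrict measurableSet_Ioc, hsub]
    simp [hle]
  have hI : ∀ κ κ' : Fin n → Fin M,
      Integrable (fun x : Fin n → ℝ => ∏ i, (D (κ i) (x i) * D (κ' i) (x i))) (cubeMeasure n T) := by
    intro κ κ'
    rw [cubeMeasure_eq_pi]
    refine Integrable.fintype_prod (f := fun i s => D (κ i) s * D (κ' i) s)
      (μ := fun _ => volume.restrict (Set.Icc (0 : ℝ) T)) fun i => ?_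
    rw [hmul]
    split_ifs
    · exact hD1 _
    · exact integrable_zero _ _ _
  have hval : ∀ κ κ' : Fin n → Fin M, ∫ x, ∏ i, (D (κ i) (x i) * D (κ' i) (x i))
      ∂(cubeMeasure n T) = if κ = κ' then ∏ i, ((p (κ i).succ : ℝ) - p (κ i).castSucc) else 0 := by
    intro κ κ'
    rw [cubeMeasure_eq_pi]
    refine (integral_fintype_prod_eq_prod
      (μ := fun _ : Fin n => volume.restrict (Set.Icc (0 : ℝ) T)) fun i s =>
      D (κ i) s * D (κ' i) s).trans ?_
    split_ifs with h
    · subst h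
      refine Finset.prod_congr rfl fun i _ => ?_
      rw [hmul, if_pos rfl, hDint]
    · obtain ⟨i, hi⟩ := Function.ne_iff.1 h
      refine Finset.prod_eq_zero (Finset.mem_univ i) ?_
      rw [hmul, if_neg hi]
      simp
  have hsq : ∀ x : Fin n → ℝ, (∑ κ, A κ * ∏ i, D (κ i) (x i)) ^ 2 =
      ∑ κ, ∑ κ', A κ * A κ' * ∏ i, (D (κ i) (x i) * D (κ' i) (x i)) := by
    intro x
    rw [sq, Finset.sum_mul_sum]
    refine Finset.sum_congr rfl fun κ _ => Finset.sum_congr rfl fun κ' _ => ?_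
    rw [Finset.prod_mul_distrib]
    ring
  change ∫ x, (∑ κ, A κ * ∏ i, D (κ i) (x i)) ^ 2 ∂(cubeMeasure n T) = _
  simp only [hsq]
  rw [integral_finsetSum _ fun κ _ => integrable_finsetSum _ fun κ' _ => (hI κ κ').const_mul _]
  refine Finset.sum_congr rfl fun κ _ => ?_
  rw [integral_finsetSum _ fun κ' _ => (hI κ κ').const_mul _]
  simp only [integral_const_mul, hval]
  simp [sq]

/-! ### Second moments of products of Brownian increments -/

section Brownian

variable {Ω : Type*} [MeasurableSpace Ω] {P : Measure Ω} {W : ℝ≥0 → Ω → ℝ}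

lemma memLp_prod_increments (hW : IsPreBrownianReal W P) {ι : Type*} (s : Finset ι)
    (a b : ι → ℝ≥0) : MemLp (fun ω => ∏ i ∈ s, (W (b i) ω - W (a i) ω)) 2 P := by
  have : IsProbabilityMeasure P := hW.isGaussianProcess.isProbabilityMeasure
  -- Hölder with Gaussian factors, which have all moments: `card / (2 (card + 1)) ≤ 1 / 2`. The `+
  -- 1` keeps the exponent nonzero for empty `s`.
  have h := MemLp.prod' (μ := P) (f := fun i ω => W (b i) ω - W (a i) ω) (s := s)
    (p := fun _ => (2 * (s.card + 1) : ℕ)) fun i _ =>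
      HasGaussianLaw.memLp (hW.hasLaw_sub (b i) (a i)).hasGaussianLaw (ENNReal.natCast_ne_top _)
  refine h.mono_exponent ?_
  rw [Finset.sum_const, nsmul_eq_mul, ENNReal.le_inv_iff_le_inv, ← div_eq_mul_inv]
  refine ENNReal.div_le_of_le_mul ?_
  push_cast
  rw [← mul_assoc, ENNReal.inv_mul_cancel (by simp) (by simp), one_mul]
  exact le_self_add

/-- Independence factorises the expectation: a cell in both sets contributes its length, and a cell
in exactly one contributes a mean, which is zero. -/
lemma integral_prod_increments (hW : IsPreBrownianReal W P) {M : ℕ} {p : Fin (M + 1) → ℝ≥0}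
    (hp : Monotone p) (S S' : Finset (Fin M)) :
    ∫ ω, (∏ k ∈ S, (W (p k.succ) ω - W (p k.castSucc) ω)) *
        ∏ k ∈ S', (W (p k.succ) ω - W (p k.castSucc) ω) ∂P =
      if S = S' then ∏ k ∈ S, ((p k.succ : ℝ) - p k.castSucc) else 0 := by
  have : IsProbabilityMeasure P := hW.isGaussianProcess.isProbabilityMeasure
  let ξ : Fin M → Ω → ℝ := fun k ω => W (p k.succ) ω - W (p k.castSucc) ω
  have hind : iIndepFun ξ P := hW.hasIndepIncrements M p hp
  have hlaw : ∀ k, HasLaw (ξ k) (gaussianReal 0 (nndist (p k.succ).1 (p k.castSucc).1)) P :=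
    fun k => hW.hasLaw_sub _ _
  have hξ1 : ∀ k, ∫ ω, ξ k ω ∂P = 0 := fun k => by
    rw [(hlaw k).integral_eq, integral_id_gaussianReal]
  have hξ2 : ∀ k, ∫ ω, ξ k ω * ξ k ω ∂P = (p k.succ : ℝ) - p k.castSucc := by
    intro k
    have hv := (hlaw k).variance_eq
    rw [variance_id_gaussianReal, variance_of_integral_eq_zero (hlaw k).aemeasurable (hξ1 k)] at hv
    have hle : (p k.castSucc : ℝ) ≤ p k.succ := hp Fin.castSucc_lt_succ.le
    simp only [← sq]
    rw [hv, coe_nndist, Real.dist_eq]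
    exact abs_of_nonneg (sub_nonneg.2 hle)
  let g : Fin M → ℝ → ℝ := fun k y => (if k ∈ S then y else 1) * if k ∈ S' then y else 1
  have hprod : ∀ ω, (∏ k ∈ S, ξ k ω) * ∏ k ∈ S', ξ k ω = ∏ k, g k (ξ k ω) := by
    intro ω
    simp only [g]
    rw [Finset.prod_mul_distrib, Finset.prod_ite_mem, Finset.prod_ite_mem, Finset.univ_inter,
      Finset.univ_inter]
  change ∫ ω, (∏ k ∈ S, ξ k ω) * ∏ k ∈ S', ξ k ω ∂P = _
  rw [integral_congr_ae (ae_of_all _ hprod),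
    hind.integral_fun_prod_comp (fun k => (hlaw k).aemeasurable)]
  · split_ifs with h
    · subst h
      rw [← Finset.prod_subset (Finset.subset_univ S)]
      · exact Finset.prod_congr rfl fun k hk => by simpa [g, hk] using hξ2 k
      · intro k _ hk
        simp [g, hk]
    · obtain ⟨k, hk⟩ : ∃ k, ¬ (k ∈ S ↔ k ∈ S') := by
        by_contra hcon
        push Not at hcon
        exact h (Finset.ext hcon)
      refine Finset.prod_eq_zero (Finset.mem_univ k) ?_
      by_cases h1 : k ∈ S <;> by_cases h2 : k ∈ S' <;> simp_all [g]
  · intro k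
    refine Measurable.aestronglyMeasurable ?_
    by_cases h1 : k ∈ S <;> by_cases h2 : k ∈ S' <;> simp only [g, h1, h2, if_true, if_false] <;>
      fun_prop

lemma memLp_simpleIntegral (hW : IsPreBrownianReal W P) (α : OffDiagonalRect n T →₀ ℝ) :
    MemLp (simpleIntegral W α) 2 P := by
  have h := memLp_finsetSum (p := 2) (μ := P) α.support (f := fun Δ ω =>
    α Δ * ∏ i, (W (Δ.b i) ω - W (Δ.a i) ω))
    fun Δ _ => (memLp_prod_increments hW Finset.univ Δ.a Δ.b).const_mul (α Δ)
  exact h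

/-- Products over cells see only the set of cells, so `κ` is correlated with its rearrangements. By
`2ab ≤ a² + b²` it suffices to count the `κ'` with the same image as `κ`; there are at most `n ^ n`,
as all values lie in a set of at most `n` elements. -/
lemma sum_sum_mul_le_of_image_eq {M : ℕ} (A : (Fin n → Fin M) → ℝ) (w : Finset (Fin M) → ℝ)
    (hw : ∀ S, 0 ≤ w S) :
    ∑ κ, ∑ κ', A κ * A κ' * (if Finset.univ.image κ = Finset.univ.image κ' then
        w (Finset.univ.image κ) else 0) ≤
      n ^ n * ∑ κ, A κ ^ 2 * w (Finset.univ.image κ) := by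
  let R : (Fin n → Fin M) → (Fin n → Fin M) → ℝ := fun κ κ' =>
    if Finset.univ.image κ = Finset.univ.image κ' then w (Finset.univ.image κ) else 0
  have hR0 : ∀ κ κ', 0 ≤ R κ κ' := fun κ κ' => by
    simp only [R]
    split_ifs
    exacts [hw _, le_rfl]
  have hRsymm : ∀ κ κ', R κ κ' = R κ' κ := fun κ κ' => by
    simp only [R]
    by_cases h : Finset.univ.image κ = Finset.univ.image κ'
    · simp [h]
    · simp [h, Ne.symm h]
  have hcount : ∀ κ, ∑ κ', R κ κ' ≤ n ^ n * w (Finset.univ.image κ) := by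
    intro κ
    simp only [R]
    rw [← Finset.sum_filter, Finset.sum_const, nsmul_eq_mul]
    refine mul_le_mul_of_nonneg_right ?_ (hw _)
    have hsub : (Finset.univ.filter fun κ' : Fin n → Fin M =>
        Finset.univ.image κ = Finset.univ.image κ') ⊆
        Fintype.piFinset fun _ : Fin n => Finset.univ.image κ := by
      intro κ' hκ'
      rw [Finset.mem_filter] at hκ'
      rw [Fintype.mem_piFinset]
      intro i
      rw [hκ'.2]
      exact Finset.mem_image_of_mem _ (Finset.mem_univ i)
    have hcard := Finset.card_le_card hsub
    rw [Fintype.card_piFinset_const] at hcard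
    have himg : (Finset.univ.image κ).card ≤ n := by
      simpa using Finset.card_image_le (s := Finset.univ) (f := κ)
    exact_mod_cast hcard.trans (by simpa using Nat.pow_le_pow_left himg n)
  have hdiag : ∑ κ, ∑ κ', A κ ^ 2 * R κ κ' ≤ n ^ n * ∑ κ, A κ ^ 2 * w (Finset.univ.image κ) := by
    rw [Finset.mul_sum]
    refine Finset.sum_le_sum fun κ _ => ?_
    rw [← Finset.mul_sum]
    have := mul_le_mul_of_nonneg_left (hcount κ) (sq_nonneg (A κ))
    linarith
  have hswap : ∑ κ, ∑ κ', A κ' ^ 2 * R κ κ' = ∑ κ, ∑ κ', A κ ^ 2 * R κ κ' := by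
    rw [Finset.sum_comm]
    simp only [hRsymm]
  have hle : ∑ κ, ∑ κ', A κ * A κ' * R κ κ' ≤
      ∑ κ, ∑ κ', (A κ ^ 2 * R κ κ' / 2 + A κ' ^ 2 * R κ κ' / 2) := by
    refine Finset.sum_le_sum fun κ _ => Finset.sum_le_sum fun κ' _ => ?_
    have := mul_nonneg (sq_nonneg (A κ - A κ')) (hR0 κ κ')
    nlinarith
  simp only [Finset.sum_add_distrib, ← Finset.sum_div] at hle
  change ∑ κ, ∑ κ', A κ * A κ' * R κ κ' ≤ _
  linarith

/-- The second moment of the multiple integral of a simple function is controlled by the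
`L²` norm of the function. -/
lemma integral_sq_simpleIntegral_le (hW : IsPreBrownianReal W P)
    (α : OffDiagonalRect n T →₀ ℝ) :
    ∫ ω, simpleIntegral W α ω ^ 2 ∂P ≤ n ^ n * ∫ x, simpleFun α x ^ 2 ∂(cubeMeasure n T) := by
  obtain ⟨M, p, A, hp, hpT, hA, hexp⟩ := exists_grid_expansion α
  have hle : ∀ k : Fin M, (p k.castSucc : ℝ) ≤ p k.succ := fun k => hp Fin.castSucc_lt_succ.le
  let w : Finset (Fin M) → ℝ := fun S => ∏ k ∈ S, ((p k.succ : ℝ) - p k.castSucc)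
  have hf : ∀ x, simpleFun α x = ∑ κ, A κ * ∏ i, (Set.Ioc (p (κ i).castSucc : ℝ)
      (p (κ i).succ)).indicator (fun _ => (1 : ℝ)) (x i) := by
    intro x
    rw [simpleFun_eq_sum_sub, hexp fun i s => if x i ≤ s then 1 else 0]
    refine Finset.sum_congr rfl fun κ _ => ?_
    simp only [indicator_Ioc_eq_sub (hp Fin.castSucc_lt_succ.le)]
  have hX : ∀ ω, simpleIntegral W α ω = ∑ κ, A κ * ∏ k ∈ Finset.univ.image κ,
      (W (p k.succ) ω - W (p k.castSucc) ω) := by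
    intro ω
    rw [simpleIntegral, hexp fun _ s => W s ω]
    refine Finset.sum_congr rfl fun κ _ => ?_
    -- For noninjective `κ` the product over the image differs from the product over coordinates,
    -- but the coefficient is zero.
    by_cases hκ : Function.Injective κ
    · rw [Finset.prod_image fun _ _ _ _ h => hκ h]
    · simp [hA κ hκ]
  have hsq : ∀ ω, simpleIntegral W α ω ^ 2 = ∑ κ, ∑ κ', A κ * A κ' *
      ((∏ k ∈ Finset.univ.image κ, (W (p k.succ) ω - W (p k.castSucc) ω)) *
        ∏ k ∈ Finset.univ.image κ', (W (p k.succ) ω - W (p k.castSucc) ω)) := by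
    intro ω
    rw [hX, sq, Finset.sum_mul_sum]
    refine Finset.sum_congr rfl fun κ _ => Finset.sum_congr rfl fun κ' _ => ?_
    ring
  have hI : ∀ S S' : Finset (Fin M), Integrable (fun ω =>
      (∏ k ∈ S, (W (p k.succ) ω - W (p k.castSucc) ω)) *
        ∏ k ∈ S', (W (p k.succ) ω - W (p k.castSucc) ω)) P := fun S S' =>
    (memLp_prod_increments hW S (fun k => p k.castSucc) fun k => p k.succ).integrable_mul
      (memLp_prod_increments hW S' (fun k => p k.castSucc) fun k => p k.succ)
  simp only [hsq, hf]
  rw [integral_sq_sum_cells hp hpT,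
    integral_finsetSum _ fun κ _ => integrable_finsetSum _ fun κ' _ => (hI _ _).const_mul _]
  simp only [fun κ => integral_finsetSum (μ := P) Finset.univ fun κ' _ =>
    (hI (Finset.univ.image κ) (Finset.univ.image κ')).const_mul (A κ * A κ')]
  simp only [integral_const_mul, integral_prod_increments hW hp]
  refine (sum_sum_mul_le_of_image_eq A w fun S =>
    Finset.prod_nonneg fun k _ => sub_nonneg.2 (hle k)).trans (le_of_eq ?_)
  congr 1
  refine Finset.sum_congr rfl fun κ _ => ?_
  by_cases hκ : Function.Injective κ
  · simp only [w]
    rw [Finset.prod_image fun _ _ _ _ h => hκ h]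
  · simp [hA κ hκ]

end Brownian

/-! ### Existence of the multiple Wiener–Itô integral -/

lemma memLp_simpleFun (α : OffDiagonalRect n T →₀ ℝ) :
    MemLp (simpleFun α) 2 (cubeMeasure n T) := by
  have h := memLp_finsetSum (p := 2) (μ := cubeMeasure n T) α.support (f := fun Δ x =>
    α Δ * Δ.toSet.indicator (fun _ => (1 : ℝ)) x)
    fun Δ _ => MemLp.const_mul (f := Δ.toSet.indicator fun _ => (1 : ℝ))
      (MemLp.indicator Δ.measurableSet_toSet (memLp_const 1)) (α Δ)
  exact h

lemma simpleFun_sub (α β : OffDiagonalRect n T →₀ ℝ) (x : Fin n → ℝ) :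
    simpleFun (α - β) x = simpleFun α x - simpleFun β x :=
  Finsupp.sum_sub_index fun _ _ _ => sub_mul _ _ _

lemma simpleIntegral_sub {Ω : Type*} (W : ℝ≥0 → Ω → ℝ) (α β : OffDiagonalRect n T →₀ ℝ) (ω : Ω) :
    simpleIntegral W (α - β) ω = simpleIntegral W α ω - simpleIntegral W β ω :=
  Finsupp.sum_sub_index fun _ _ _ => sub_mul _ _ _

lemma eLpNorm_two_eq_ofReal_sqrt {X : Type*} [MeasurableSpace X] {μ : Measure X} {g : X → ℝ}
    (hg : MemLp g 2 μ) : eLpNorm g 2 μ = ENNReal.ofReal √(∫ x, g x ^ 2 ∂μ) := by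
  rw [hg.eLpNorm_eq_integral_rpow_norm two_ne_zero ENNReal.ofNat_ne_top, Real.sqrt_eq_rpow]
  simp

lemma eLpNorm_sub_rev {X : Type*} [MeasurableSpace X] {μ : Measure X} {p : ℝ≥0∞} (f g : X → ℝ) :
    eLpNorm (fun x => f x - g x) p μ = eLpNorm (fun x => g x - f x) p μ :=
  eLpNorm_sub_comm f g p μ

section Brownian

variable {Ω : Type*} [MeasurableSpace Ω] {P : Measure Ω} {W : ℝ≥0 → Ω → ℝ}

/-- Together with linearity, this makes the integrals of an `L²`-convergent sequence of simple
functions Cauchy in `L²(P)`. -/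
lemma eLpNorm_simpleIntegral_le (hW : IsPreBrownianReal W P) (α : OffDiagonalRect n T →₀ ℝ) :
    eLpNorm (simpleIntegral W α) 2 P ≤
      ENNReal.ofReal √(n ^ n) * eLpNorm (simpleFun α) 2 (cubeMeasure n T) := by
  rw [eLpNorm_two_eq_ofReal_sqrt (memLp_simpleIntegral hW α),
    eLpNorm_two_eq_ofReal_sqrt (memLp_simpleFun α), ← ENNReal.ofReal_mul (Real.sqrt_nonneg _),
    ← Real.sqrt_mul (by positivity)]
  exact ENNReal.ofReal_le_ofReal (Real.sqrt_le_sqrt (integral_sq_simpleIntegral_le hW α))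

/-- The multiple Wiener–Itô integral of a square integrable function exists. -/
lemma exists_isMultipleWienerIto (hW : IsPreBrownianReal W P) {f : (Fin n → ℝ) → ℝ}
    (hf : MemLp f 2 (cubeMeasure n T)) : ∃ X, IsMultipleWienerIto P W T f X := by
  obtain ⟨α, hα⟩ := exists_seq_simpleFun_tendsto hf
  let I : ℕ → Lp ℝ 2 P := fun k => (memLp_simpleIntegral hW (α k)).toLp
  have hdist : ∀ k l, edist (I k) (I l) ≤ ENNReal.ofReal √(n ^ n) *
      (eLpNorm (fun x => simpleFun (α k) x - f x) 2 (cubeMeasure n T) +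
        eLpNorm (fun x => simpleFun (α l) x - f x) 2 (cubeMeasure n T)) := by
    intro k l
    rw [Lp.edist_toLp_toLp]
    have h1 : simpleIntegral W (α k) - simpleIntegral W (α l) = simpleIntegral W (α k - α l) :=
      funext fun ω => (simpleIntegral_sub W (α k) (α l) ω).symm
    rw [h1]
    refine (eLpNorm_simpleIntegral_le hW _).trans (mul_le_mul_right ?_ _)
    have h2 : simpleFun (α k - α l) =
        (fun x => simpleFun (α k) x - f x) - fun x => simpleFun (α l) x - f x := by
      ext x
      rw [simpleFun_sub, Pi.sub_apply]
      ring
    rw [h2]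
    exact eLpNorm_sub_le ((memLp_simpleFun _).sub hf).1 ((memLp_simpleFun _).sub hf).1 one_le_two
  have hcauchy : CauchySeq I := by
    rw [EMetric.cauchySeq_iff]
    intro e he
    have hlim : Tendsto (fun q : ℕ × ℕ => ENNReal.ofReal √(n ^ n) *
        (eLpNorm (fun x => simpleFun (α q.1) x - f x) 2 (cubeMeasure n T) +
          eLpNorm (fun x => simpleFun (α q.2) x - f x) 2 (cubeMeasure n T))) atTop (𝓝 0) := by
      have := ENNReal.Tendsto.const_mul (a := ENNReal.ofReal √(n ^ n))
        ((hα.comp tendsto_fst).add (hα.comp tendsto_snd)) (Or.inr ENNReal.ofReal_ne_top)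
      rw [prod_atTop_atTop_eq] at this
      simpa using this
    obtain ⟨N, hN⟩ := eventually_atTop.1 ((tendsto_order.1 hlim).2 e he)
    refine ⟨max N.1 N.2, fun k hk l hl => (hdist k l).trans_lt (hN (k, l) ⟨?_, ?_⟩)⟩
    · exact (le_max_left _ _).trans hk
    · exact (le_max_right _ _).trans hl
  obtain ⟨X, hX⟩ := cauchySeq_tendsto_of_complete hcauchy
  refine ⟨X, Lp.memLp X, α, hα, ?_⟩
  rw [Lp.tendsto_Lp_iff_tendsto_eLpNorm'] at hX
  refine hX.congr fun k => eLpNorm_congr_ae ?_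
  filter_upwards [(memLp_simpleIntegral hW (α k)).coeFn_toLp] with ω hω
  rw [Pi.sub_apply, hω]

lemma isMultipleWienerIto_multipleWienerIto (hW : IsPreBrownianReal W P) {f : (Fin n → ℝ) → ℝ}
    (hf : MemLp f 2 (cubeMeasure n T)) :
    IsMultipleWienerIto P W T f (multipleWienerIto P W T f) := by
  have h := exists_isMultipleWienerIto hW hf
  rw [multipleWienerIto, dif_pos h]
  exact h.choose_spec

end Brownian

/-! ### Pathwise truncated integrals -/

lemma memLp_prod_apply {g : ℝ → ℝ} (hg : MemLp g 2 (volume.restrict (Set.Icc (0 : ℝ) T))) :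
    MemLp (fun x : Fin n → ℝ => ∏ i, g (x i)) 2 (cubeMeasure n T) := by
  have h1 : Integrable (fun x : Fin n → ℝ => ∏ i, g (x i)) (cubeMeasure n T) := by
    rw [cubeMeasure_eq_pi]
    exact Integrable.fintype_prod (f := fun _ => g)
      (μ := fun _ => volume.restrict (Set.Icc (0 : ℝ) T)) fun _ => hg.integrable one_le_two
  rw [memLp_two_iff_integrable_sq h1.aestronglyMeasurable]
  simp only [← Finset.prod_pow]
  rw [cubeMeasure_eq_pi]
  exact Integrable.fintype_prod (f := fun _ s => g s ^ 2)
    (μ := fun _ => volume.restrict (Set.Icc (0 : ℝ) T)) fun _ => hg.integrable_sq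

/-- Fubini: indicator and product of densities both split over the coordinates. -/
lemma integral_indicator_rect_mul_prod {g : ℝ → ℝ}
    (hg : MemLp g 2 (volume.restrict (Set.Icc (0 : ℝ) T))) (Δ : OffDiagonalRect n T) :
    ∫ x, Δ.toSet.indicator (fun _ => (1 : ℝ)) x * ∏ i, g (x i) ∂(cubeMeasure n T) =
      ∏ i, (primitivePath g (Δ.b i) - primitivePath g (Δ.a i)) := by
  have hgi : IntegrableOn g (Set.Icc (0 : ℝ) T) := hg.integrable one_le_two
  have hint : ∀ s : ℝ≥0, s ≤ T → IntervalIntegrable g volume 0 s := fun s hs =>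
    (intervalIntegrable_iff_integrableOn_Icc_of_le s.coe_nonneg).2
      (hgi.mono_set (Set.Icc_subset_Icc_right hs))
  simp only [Δ.indicator_toSet, ← Finset.prod_mul_distrib]
  rw [cubeMeasure_eq_pi]
  refine (integral_fintype_prod_eq_prod (E := fun _ => ℝ)
    (μ := fun _ : Fin n => volume.restrict (Set.Icc (0 : ℝ) T)) fun i s =>
      (Set.Ioc (Δ.a i : ℝ) (Δ.b i)).indicator (fun _ => 1) s * g s).trans ?_
  refine Finset.prod_congr rfl fun i _ => ?_
  have h1 : (fun s => (Set.Ioc (Δ.a i : ℝ) (Δ.b i)).indicator (fun _ => 1) s * g s) =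
      (Set.Ioc (Δ.a i : ℝ) (Δ.b i)).indicator g := by
    ext s
    by_cases hs : s ∈ Set.Ioc (Δ.a i : ℝ) (Δ.b i) <;> simp [hs]
  have hsub : Set.Ioc (Δ.a i : ℝ) (Δ.b i) ∩ Set.Icc 0 (T : ℝ) =
      Set.Ioc (Δ.a i : ℝ) (Δ.b i) :=
    Set.inter_eq_left.2 fun s hs =>
      ⟨(Δ.a i).coe_nonneg.trans hs.1.le, hs.2.trans (NNReal.coe_le_coe.2 (Δ.le_T i))⟩
  rw [h1, integral_indicator measurableSet_Ioc, Measure.restrict_restrict measurableSet_Ioc, hsub,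
    primitivePath, primitivePath, intervalIntegral.integral_interval_sub_left
      (hint _ (Δ.le_T i)) (hint _ ((Δ.le i).trans (Δ.le_T i))),
    intervalIntegral.integral_of_le (NNReal.coe_le_coe.2 (Δ.le i))]

/-- The pathwise integral of a simple function is given by the increments of the path. -/
lemma integral_simpleFun_mul_prod {Ω : Type*} {θ : ℝ → Ω → ℝ} {ω : Ω}
    (hg : MemLp (fun s => θ s ω) 2 (volume.restrict (Set.Icc (0 : ℝ) T)))
    (α : OffDiagonalRect n T →₀ ℝ) :
    ∫ x, simpleFun α x * ∏ i, θ (x i) ω ∂(cubeMeasure n T) =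
      simpleIntegral (fun t ω => primitivePath (fun s => θ s ω) t) α ω := by
  have hI : ∀ Δ : OffDiagonalRect n T, Integrable (fun x : Fin n → ℝ =>
      Δ.toSet.indicator (fun _ => (1 : ℝ)) x * ∏ i, θ (x i) ω) (cubeMeasure n T) := fun Δ =>
    MemLp.integrable_mul (p := 2) (q := 2) (MemLp.indicator Δ.measurableSet_toSet (memLp_const 1))
      (memLp_prod_apply hg)
  simp only [simpleFun, simpleIntegral, Finsupp.sum, Finset.sum_mul, mul_assoc]
  rw [integral_finsetSum _ fun Δ _ => (hI Δ).const_mul _]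
  refine Finset.sum_congr rfl fun Δ _ => ?_
  rw [integral_const_mul, integral_indicator_rect_mul_prod hg]

lemma measurable_offDiagonalCutoff (ε : ℝ) :
    Measurable (offDiagonalCutoff ε : (Fin n → ℝ) → ℝ) := by
  refine Finset.measurable_prod _ fun p _ => measurable_const.indicator ?_
  exact measurableSet_lt measurable_const (by fun_prop)

lemma abs_offDiagonalCutoff_le_one (ε : ℝ) (x : Fin n → ℝ) : |offDiagonalCutoff ε x| ≤ 1 := by
  rw [offDiagonalCutoff, Finset.abs_prod]
  refine Finset.prod_le_one (fun _ _ => abs_nonneg _) fun p _ => ?_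
  by_cases h : x ∈ {y : Fin n → ℝ | ε < |y p.1 - y p.2|} <;> simp only [h, Set.indicator_of_mem,
    Set.indicator_of_notMem, not_false_eq_true] <;> simp

lemma MeasureTheory.MemLp.mul_offDiagonalCutoff {f : (Fin n → ℝ) → ℝ}
    (hf : MemLp f 2 (cubeMeasure n T)) (ε : ℝ) :
    MemLp (fun x => f x * offDiagonalCutoff ε x) 2 (cubeMeasure n T) := by
  refine hf.mono (hf.1.mul (measurable_offDiagonalCutoff ε).aestronglyMeasurable)
    (ae_of_all _ fun x => ?_)
  rw [norm_mul]
  exact mul_le_of_le_one_right (norm_nonneg _) (abs_offDiagonalCutoff_le_one ε x)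

lemma truncatedIntegral_eq_integral_cubeMeasure (f : (Fin n → ℝ) → ℝ) (ε : ℝ) (g : ℝ → ℝ)
    {t : ℝ≥0} (ht : t ≤ T) : truncatedIntegral f ε g t =
      ∫ x, (cube n t).indicator f x * offDiagonalCutoff ε x * ∏ i, g (x i) ∂(cubeMeasure n T) := by
  have hsub : cube n t ∩ cube n T = cube n t :=
    Set.inter_eq_left.2 (Set.pi_mono fun _ _ => Set.Icc_subset_Icc_right ht)
  have h1 : (fun x => (cube n t).indicator f x * offDiagonalCutoff ε x * ∏ i, g (x i)) =
      (cube n t).indicator fun x => f x * (∏ i, g (x i)) * offDiagonalCutoff ε x := by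
    ext x
    by_cases hx : x ∈ cube n t
    · simp only [hx, Set.indicator_of_mem]
      ring
    · simp [hx]
  rw [h1, integral_indicator (measurableSet_cube n t), cubeMeasure,
    Measure.restrict_restrict (measurableSet_cube n t), hsub, truncatedIntegral]

lemma truncatedIntegral_self (f : (Fin n → ℝ) → ℝ) (ε : ℝ) (g : ℝ → ℝ) :
    truncatedIntegral f ε g T =
      ∫ x, f x * offDiagonalCutoff ε x * ∏ i, g (x i) ∂(cubeMeasure n T) := by
  rw [truncatedIntegral_eq_integral_cubeMeasure f ε g le_rfl]
  refine integral_congr_ae ?_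
  filter_upwards [ae_restrict_mem (measurableSet_cube n T)] with x hx
  rw [Set.indicator_of_mem hx]

/-- Moves the time parameter into the integrand, so that only time `T` has to be treated. -/
lemma truncatedIntegral_eq_indicator (f : (Fin n → ℝ) → ℝ) (ε : ℝ) (g : ℝ → ℝ)
    {t : ℝ≥0} (ht : t ≤ T) :
    truncatedIntegral f ε g t = truncatedIntegral ((cube n t).indicator f) ε g T := by
  rw [truncatedIntegral_self (T := T), truncatedIntegral_eq_integral_cubeMeasure f ε g ht]

lemma truncatedIntegral_sub {f₁ f₂ : (Fin n → ℝ) → ℝ} (hf₁ : MemLp f₁ 2 (cubeMeasure n T))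
    (hf₂ : MemLp f₂ 2 (cubeMeasure n T)) (ε : ℝ) {g : ℝ → ℝ}
    (hg : MemLp g 2 (volume.restrict (Set.Icc (0 : ℝ) T))) :
    truncatedIntegral (fun x => f₁ x - f₂ x) ε g T =
      truncatedIntegral f₁ ε g T - truncatedIntegral f₂ ε g T := by
  simp only [truncatedIntegral_self, sub_mul]
  exact integral_sub ((hf₁.mul_offDiagonalCutoff ε).integrable_mul (memLp_prod_apply hg))
    ((hf₂.mul_offDiagonalCutoff ε).integrable_mul (memLp_prod_apply hg))

/-- Disjoint nonempty closed intervals are separated by a positive gap; this is where disjointness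
of the closed sides matters. -/
lemma OffDiagonalRect.exists_pos_lt_abs_sub (Δ : OffDiagonalRect n T) {h l : Fin n}
    (hl : h ≠ l) : ∃ c > 0, ∀ x ∈ Δ.toSet, c < |x h - x l| := by
  have hdisj := Set.disjoint_left.1 (Δ.disjoint hl)
  have hcases : Δ.b h < Δ.a l ∨ Δ.b l < Δ.a h := by
    by_contra hcon
    push Not at hcon
    exact hdisj (a := max (Δ.a h) (Δ.a l)) ⟨le_max_left _ _, max_le (Δ.le h) hcon.1⟩
      ⟨le_max_right _ _, max_le hcon.2 (Δ.le l)⟩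
  have hx : ∀ x ∈ Δ.toSet, ∀ i, (Δ.a i : ℝ) < x i ∧ x i ≤ Δ.b i := fun x hx i =>
    hx i (Set.mem_univ i)
  rcases hcases with hlt | hlt
  · refine ⟨Δ.a l - Δ.b h, sub_pos.2 (NNReal.coe_lt_coe.2 hlt), fun x hxm => ?_⟩
    rw [abs_sub_comm]
    refine lt_of_lt_of_le ?_ (le_abs_self _)
    linarith [(hx x hxm h).2, (hx x hxm l).1]
  · refine ⟨Δ.a h - Δ.b l, sub_pos.2 (NNReal.coe_lt_coe.2 hlt), fun x hxm => ?_⟩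
    refine lt_of_lt_of_le ?_ (le_abs_self _)
    linarith [(hx x hxm l).2, (hx x hxm h).1]

/-- A simple function over off-diagonal rectangles is not affected by the removal of small
strips around the diagonals. -/
lemma eventually_simpleFun_mul_offDiagonalCutoff (α : OffDiagonalRect n T →₀ ℝ) :
    ∀ᶠ ε in 𝓝 (0 : ℝ), ∀ x, simpleFun α x * offDiagonalCutoff ε x = simpleFun α x := by
  have h1 : ∀ᶠ ε in 𝓝 (0 : ℝ), ∀ Δ ∈ α.support, ∀ x ∈ Δ.toSet, offDiagonalCutoff ε x = 1 := by
    refine (Finset.eventually_all α.support).2 fun Δ _ => ?_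
    have h2 : ∀ᶠ ε in 𝓝 (0 : ℝ), ∀ p ∈ (Finset.univ : Finset (Fin n)).offDiag,
        ∀ x ∈ Δ.toSet, ε < |x p.1 - x p.2| := by
      refine (Finset.eventually_all _).2 fun p hp => ?_
      obtain ⟨c, hc, hcx⟩ := Δ.exists_pos_lt_abs_sub (Finset.mem_offDiag.1 hp).2.2
      filter_upwards [eventually_lt_nhds hc] with ε hε x hx using hε.trans (hcx x hx)
    filter_upwards [h2] with ε hε x hx
    exact Finset.prod_eq_one fun p hp =>
      Set.indicator_of_mem (s := {y : Fin n → ℝ | ε < |y p.1 - y p.2|}) (hε p hp x hx) _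
  filter_upwards [h1] with ε hε x
  simp only [simpleFun, Finsupp.sum, Finset.sum_mul]
  refine Finset.sum_congr rfl fun Δ hΔ => ?_
  by_cases hx : x ∈ Δ.toSet
  · rw [hε Δ hΔ x hx, mul_one]
  · simp [hx]

/-- Cauchy–Schwarz turns `L²` convergence of `s k` into `L¹` convergence of the products. -/
lemma tendsto_integral_mul_of_tendsto_eLpNorm_two {X : Type*} [MeasurableSpace X] {μ : Measure X}
    {F G : X → ℝ} {s : ℕ → X → ℝ} (hs : ∀ k, MemLp (s k) 2 μ) (hF : MemLp F 2 μ)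
    (hG : MemLp G 2 μ) (h : Tendsto (fun k => eLpNorm (fun x => s k x - F x) 2 μ) atTop (𝓝 0)) :
    Tendsto (fun k => ∫ x, s k x * G x ∂μ) atTop (𝓝 (∫ x, F x * G x ∂μ)) := by
  refine tendsto_integral_of_L1' _ (hF.integrable_mul hG).aestronglyMeasurable
    (Eventually.of_forall fun k => (hs k).integrable_mul hG) ?_
  refine tendsto_of_tendsto_of_tendsto_of_le_of_le tendsto_const_nhds
    (h := fun k => eLpNorm (fun x => s k x - F x) 2 μ * eLpNorm G 2 μ) ?_ (fun _ => zero_le)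
    fun k => ?_
  · simpa using ENNReal.Tendsto.mul_const h (Or.inr hG.2.ne)
  · have h1 : (fun x => s k x * G x) - F * G = (fun x => s k x - F x) • G := by
      ext x
      simp [sub_mul]
    rw [h1]
    exact eLpNorm_smul_le_mul_eLpNorm hG.1 ((hs k).sub hF).1

/-! ### Measurability and convergence for simple integrands -/

lemma aemeasurable_simpleIntegral {Ω : Type*} [MeasurableSpace Ω] {P : Measure Ω}
    {W : ℝ≥0 → Ω → ℝ} (hW : ∀ t ≤ T, AEMeasurable (W t) P) (α : OffDiagonalRect n T →₀ ℝ) :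
    AEMeasurable (simpleIntegral W α) P := by
  refine Finset.aemeasurable_fun_sum _ fun Δ _ => AEMeasurable.const_mul ?_ _
  exact Finset.aemeasurable_fun_prod _ fun i _ =>
    (hW _ (Δ.le_T i)).sub (hW _ ((Δ.le i).trans (Δ.le_T i)))

/-- The truncated integral is a random variable as soon as the primitive path is a process. -/
lemma aemeasurable_truncatedIntegral {Ω : Type*} [MeasurableSpace Ω] {P : Measure Ω}
    {θ : ℝ → Ω → ℝ} (hθ : ∀ ω, MemLp (fun s => θ s ω) 2 (volume.restrict (Set.Icc (0 : ℝ) T)))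
    (hη : ∀ t ≤ T, AEMeasurable (fun ω => primitivePath (fun s => θ s ω) t) P)
    {f : (Fin n → ℝ) → ℝ} (hf : MemLp f 2 (cubeMeasure n T)) (ε : ℝ) :
    AEMeasurable (fun ω => truncatedIntegral f ε (fun s => θ s ω) T) P := by
  -- `θ` is not assumed jointly measurable. For every `ω` the integral is a limit of integrals of
  -- fixed simple functions, which are polynomials in finitely many values of the primitive path.
  obtain ⟨α, hα⟩ := exists_seq_simpleFun_tendsto (hf.mul_offDiagonalCutoff ε)
  refine aemeasurable_of_tendsto_metrizable_ae atTop
    (fun k => aemeasurable_simpleIntegral hη (α k)) (ae_of_all _ fun ω => ?_)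
  have h := tendsto_integral_mul_of_tendsto_eLpNorm_two (fun k => memLp_simpleFun (α k))
    (hf.mul_offDiagonalCutoff ε) (memLp_prod_apply (hθ ω)) hα
  simp only [integral_simpleFun_mul_prod (hθ ω)] at h
  rwa [← truncatedIntegral_self f ε fun s => θ s ω] at h

/-- Multiple integrals of simple functions inherit the convergence of finite-dimensional
distributions. -/
lemma TendstoFDD.simpleIntegral {ι Ω' : Type*} {Ω : ι → Type*} [∀ i, MeasurableSpace (Ω i)]
    [MeasurableSpace Ω'] {X : ∀ i, ℝ≥0 → Ω i → ℝ} {l : Filter ι} {Z : ℝ≥0 → Ω' → ℝ}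
    {P : ∀ i, Measure (Ω i)} [∀ i, IsProbabilityMeasure (P i)] {P' : Measure Ω'}
    [IsProbabilityMeasure P'] (h : TendstoFDD T X l Z P P') {r : ℕ}
    (α : Fin r → OffDiagonalRect n T →₀ ℝ) :
    TendstoInDistribution (fun i (ω : Ω i) (k : Fin r) => simpleIntegral (X i) (α k) ω) l
      (fun (ω : Ω') (k : Fin r) => simpleIntegral Z (α k) ω) P P' := by
  classical
  let S : Finset ℝ≥0 := Finset.univ.biUnion fun k => (α k).support.biUnion fun Δ =>
    Finset.univ.image Δ.a ∪ Finset.univ.image Δ.b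
  have ha : ∀ k, ∀ Δ ∈ (α k).support, ∀ i, Δ.a i ∈ S := fun k Δ hΔ i =>
    Finset.mem_biUnion.2 ⟨k, Finset.mem_univ k, Finset.mem_biUnion.2
      ⟨Δ, hΔ, Finset.mem_union_left _ (Finset.mem_image_of_mem _ (Finset.mem_univ i))⟩⟩
  have hb : ∀ k, ∀ Δ ∈ (α k).support, ∀ i, Δ.b i ∈ S := fun k Δ hΔ i =>
    Finset.mem_biUnion.2 ⟨k, Finset.mem_univ k, Finset.mem_biUnion.2
      ⟨Δ, hΔ, Finset.mem_union_right _ (Finset.mem_image_of_mem _ (Finset.mem_univ i))⟩⟩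
  have hS : ∀ s ∈ S, s ≤ T := by
    intro s hs
    simp only [S, Finset.mem_biUnion, Finset.mem_union, Finset.mem_image, Finset.mem_univ,
      true_and] at hs
    obtain ⟨k, Δ, -, ⟨i, rfl⟩ | ⟨i, rfl⟩⟩ := hs
    · exact (Δ.le i).trans (Δ.le_T i)
    · exact Δ.le_T i
  let e := S.equivFin
  -- Rebuilds a path from its values at the finitely many times in `S`; the default 0 is never read.
  let path : (Fin S.card → ℝ) → ℝ≥0 → ℝ := fun y s => if hs : s ∈ S then y (e ⟨s, hs⟩) else 0
  let G : (Fin S.card → ℝ) → Fin r → ℝ := fun y k =>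
    _root_.simpleIntegral (fun s y => path y s) (α k) y
  have hpath : ∀ s, Continuous fun y => path y s := fun s => by
    by_cases hs : s ∈ S
    · simp only [path, hs, dif_pos]
      fun_prop
    · simp only [path, hs, dif_neg, not_false_eq_true]
      fun_prop
  have hG : Continuous G := by
    refine continuous_pi fun k => continuous_finsetSum _ fun Δ _ => continuous_const.mul ?_
    exact continuous_finsetProd _ fun i _ => (hpath _).sub (hpath _)
  have key := (h S.card (fun j => e.symm j) fun j => hS _ (e.symm j).2).continuous_comp hG
  refine key.congr (fun i => ae_of_all _ fun ω => ?_) (ae_of_all _ fun ω => ?_)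
  · refine funext fun k => Finset.sum_congr rfl fun Δ hΔ => ?_
    simp [path, ha k Δ hΔ, hb k Δ hΔ]
  · refine funext fun k => Finset.sum_congr rfl fun Δ hΔ => ?_
    simp [path, ha k Δ hΔ, hb k Δ hΔ]

lemma lintegral_enorm_pi_le {ι Ω : Type*} [Fintype ι] [MeasurableSpace Ω] {P : Measure Ω}
    {X : Ω → ι → ℝ} (hX : ∀ k, AEMeasurable (fun ω => X ω k) P) :
    ∫⁻ ω, ‖X ω‖ₑ ∂P ≤ ∑ k, ∫⁻ ω, ‖X ω k‖ₑ ∂P := by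
  rw [← lintegral_finsetSum' _ fun k _ => (hX k).enorm]
  refine lintegral_mono fun ω => ?_
  rw [← edist_zero_right, edist_pi_le_iff]
  intro k
  rw [Pi.zero_apply, edist_zero_right]
  exact Finset.single_le_sum (f := fun k => ‖X ω k‖ₑ) (fun _ _ => zero_le) (Finset.mem_univ k)

/-! ### The convergence theorem -/

theorem theorem2p3 {Ω : Set.Ioi (0 : ℝ) → Type*} [∀ ε, MeasurableSpace (Ω ε)]
    (P : ∀ ε, Measure (Ω ε)) [∀ ε, IsProbabilityMeasure (P ε)]
    {Ω' : Type*} [MeasurableSpace Ω'] (P' : Measure Ω') [IsProbabilityMeasure P']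
    (n : ℕ) (hn : 1 ≤ n) (T : ℝ≥0) (hT : 0 < T)
    (W : ℝ≥0 → Ω' → ℝ) (hW : IsBrownianReal W P')
    (θ : ∀ ε : Set.Ioi (0 : ℝ), ℝ → Ω ε → ℝ)
    (hθ : ∀ ε ω, MemLp (fun s => θ ε s ω) 2 (volume.restrict (Set.Icc (0 : ℝ) T)))
    (hη : TendstoFDD T (fun (ε : Set.Ioi (0 : ℝ)) t ω => primitivePath (fun s => θ ε s ω) t)
      (comap Subtype.val (𝓝[>] (0 : ℝ))) W P P')
    (hC : ∃ C : ℝ≥0, ∀ f : (Fin n → ℝ) → ℝ, MemLp f 2 (cubeMeasure n T) →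
      ∀ (ε : Set.Ioi (0 : ℝ)) (t : ℝ≥0), t ≤ T →
        ∫⁻ ω, ‖truncatedIntegral f ε (fun s => θ ε s ω) t‖ₑ ∂(P ε)
          ≤ C * eLpNorm f 2 (cubeMeasure n T))
    (f : (Fin n → ℝ) → ℝ) (hf : MemLp f 2 (cubeMeasure n T)) :
    TendstoFDD T (fun (ε : Set.Ioi (0 : ℝ)) t ω => truncatedIntegral f ε (fun s => θ ε s ω) t)
      (comap Subtype.val (𝓝[>] (0 : ℝ)))
      (fun t => multipleWienerIto P' W T ((cube n t).indicator f)) P P' := by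
  obtain ⟨C, hC⟩ := hC
  intro r t ht
  let F : Fin r → (Fin n → ℝ) → ℝ := fun k => (cube n (t k)).indicator f
  have hF : ∀ k, MemLp (F k) 2 (cubeMeasure n T) := fun k => hf.indicator (measurableSet_cube n _)
  have hI := fun k => isMultipleWienerIto_multipleWienerIto hW.toIsPreBrownianReal (hF k)
  choose α hα hαI using fun k => (hI k).2
  -- Measurability of the primitive path at one time is part of its one-dimensional convergence in
  -- distribution.
  have hηm : ∀ ε, ∀ s ≤ T, AEMeasurable (fun ω => primitivePath (fun u => θ ε u ω) s) (P ε) :=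
    fun ε s hs => aemeasurable_pi_iff.1
      ((hη 1 (fun _ => s) fun _ => hs).forall_aemeasurable ε) 0
  have htrunc : ∀ (ε : Set.Ioi (0 : ℝ)) k ω, truncatedIntegral f ε (fun s => θ ε s ω) (t k) =
      truncatedIntegral (F k) ε (fun s => θ ε s ω) T := fun ε k ω =>
    truncatedIntegral_eq_indicator f ε _ (ht k)
  have hYm : ∀ (ε : Set.Ioi (0 : ℝ)) k,
      AEMeasurable (fun ω => truncatedIntegral f ε (fun s => θ ε s ω) (t k)) (P ε) := by
    intro ε k
    simp only [htrunc]
    exact aemeasurable_truncatedIntegral (hθ ε) (hηm ε) (hF k) ε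
  have hZm : ∀ k, AEMeasurable (multipleWienerIto P' W T (F k)) P' :=
    fun k => (hI k).1.1.aemeasurable
  have hWm : ∀ s ≤ T, AEMeasurable (W s) P' := fun s _ => hW.aemeasurable s
  refine tendstoInDistribution_of_approx (aemeasurable_pi_iff.2 <| hYm ·)
    (aemeasurable_pi_iff.2 hZm) (fun m => hη.simpleIntegral fun k => α k m)
    -- One term bounds the error for `η_ε` through the assumed estimate, the other the error for
    -- `W`; the sum over `k` dominates the sup norm of the vector.
    (δ := fun m => ∑ k, (C * eLpNorm (fun x => simpleFun (α k m) x - F k x) 2 (cubeMeasure n T) +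
      eLpNorm (fun ω => simpleIntegral W (α k m) ω - multipleWienerIto P' W T (F k) ω) 2 P'))
    ?_ (fun m => ?_) fun m => ?_
  · have := tendsto_finsetSum (Finset.univ : Finset (Fin r)) fun k _ =>
      (ENNReal.Tendsto.const_mul (a := (C : ℝ≥0∞)) (hα k) (Or.inr ENNReal.coe_ne_top)).add (hαI k)
    simpa using this
  · have hev : ∀ᶠ ε : Set.Ioi (0 : ℝ) in comap Subtype.val (𝓝[>] (0 : ℝ)), ∀ k x,
        simpleFun (α k m) x * offDiagonalCutoff (ε : ℝ) x = simpleFun (α k m) x :=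
      (tendsto_comap.mono_right nhdsWithin_le_nhds).eventually
        (eventually_all.2 fun k => eventually_simpleFun_mul_offDiagonalCutoff (α k m))
    filter_upwards [hev] with ε hε
    refine (lintegral_enorm_pi_le fun k =>
      (hYm ε k).sub (aemeasurable_simpleIntegral (hηm ε) (α k m))).trans
        (Finset.sum_le_sum fun k _ => le_add_right ?_)
    -- For such `ε` the simple function ignores the cutoff, so the error is itself a truncated
    -- integral, to which the assumed bound applies.
    have heq : ∀ ω, truncatedIntegral f ε (fun s => θ ε s ω) (t k) -
        simpleIntegral (fun t ω => primitivePath (fun s => θ ε s ω) t) (α k m) ω =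
        truncatedIntegral (fun x => F k x - simpleFun (α k m) x) ε (fun s => θ ε s ω) T := by
      intro ω
      rw [htrunc, truncatedIntegral_sub (hF k) (memLp_simpleFun _) ε (hθ ε ω),
        truncatedIntegral_self (simpleFun (α k m))]
      simp only [hε k]
      rw [integral_simpleFun_mul_prod (hθ ε ω)]
    rw [eLpNorm_sub_rev]
    refine le_trans (le_of_eq (lintegral_congr fun ω => ?_))
      (hC _ ((hF k).sub (memLp_simpleFun (α k m))) ε T le_rfl)
    exact congrArg _ (heq ω)
  · refine (lintegral_enorm_pi_le fun k =>
      (aemeasurable_simpleIntegral hWm (α k m)).sub (hZm k)).trans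
        (Finset.sum_le_sum fun k _ => le_add_left ?_)
    have hm : AEStronglyMeasurable (fun ω => simpleIntegral W (α k m) ω -
        multipleWienerIto P' W T (F k) ω) P' :=
      ((aemeasurable_simpleIntegral hWm (α k m)).sub (hZm k)).aestronglyMeasurable
    refine le_trans (le_of_eq ?_) (eLpNorm_le_eLpNorm_of_exponent_le one_le_two hm)
    rw [eLpNorm_one_eq_lintegral_enorm]
    rfl
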